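/- A (finite-energy) Maya diagram is a set $B=\{j_1<j_2<\cdots\}\subset\mathbb{Z}$ (the black sites) that is bounded below and whose complement is bounded above. Let $\mathcal{F}$ be the complex vector space with basis $|B\rangle=|j_1,j_2,\ldots\rangle$ indexed by all Maya diagrams. For $m\in\mathbb{Z}$ define operators on $\mathcal{F}$ by $$\psi_m|j_1,j_2,\ldots\rangle=(-1)^{k-1}|j_1,\ldots,j_{k-1},j_{k+1},\ldots\rangle \text{ if } m=j_k,\quad \text{and } 0 \text{ if } m\notin B,$$ $$\psi^*_m|j_1,j_2,\ldots\rangle=(-1)^{k}|j_1,\ldots,j_k,m,j_{k+1},\ldots\rangle \text{ if } m\notin B,\ k=\#\{i: j_i<m\},\quad \text{and } 0 \text{ if } m\in B.$$ Let $|0\rangle=|0,1,2,\ldots\rangle$ and let $\langle 0|$ be the linear functional on $\mathcal{F}$ that is $1$ at $|0\rangle$ and $0$ at every other basis vector; operators act on functionals from the right by composition. Put $$H_m=\sum_{j\in\mathbb{Z}}\bigl(\psi_j\psi^*_{j+m}-\langle 0|\psi_j\psi^*_{j+m}|0\rangle\bigr),$$ a sum with finitely many nonzero terms on each basis vector, and,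 for an indeterminate $z$, $$\Gamma_+(z)=\exp\Bigl(-\sum_{m\ge1}\frac{z^{-m}}{m}H_m\Bigr),\qquad \Gamma_-(z)=\exp\Bigl(-\sum_{m\ge1}\frac{z^{m}}{m}H_{-m}\Bigr),$$ formal power series in $z^{-1}$, respectively $z$, whose coefficients are operators on $\mathcal{F}$. For a partition (Young diagram) $\mu$ with main diagonal of length $r$, let $m_k$ be the number of boxes strictly below the $k$-th diagonal box in its column, and let $-n_k$ be the number of boxes weakly to the right of the $k$-th diagonal box in its row $(1\le k\le r)$, so that $m_1>\cdots>m_r\ge0$ and $n_1<\cdots<n_r<0$. With $\kappa=\sum_{k=1}^r(m_k+k)$ put $$|\mu\rangle=(-1)^\kappa\psi_{m_1}\cdots\psi_{m_r}\psi^*_{n_1}\cdots\psi^*_{n_r}|0\rangle,\qquad \langle\mu|=(-1)^\kappa\langle0|\psi_{n_r}\cdots\psi_{n_1}\psi^*_{m_r}\cdots\psi^*_{m_1}.$$ Let $|\mu|$ be the number of boxes of $\mu$. Say that $\nu$ interlaces $\mu$, written $\nu\prec\mu$, if $\mu_j\ge\nu_j\ge\mu_{j+1}$ for all $j\ge1$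 (missing parts being $0$). Lemma 1. For all partitions $\mu,\nu$, as formal series in $z,z^{-1}$, $$\langle\nu|\Gamma_+(z)|\mu\rangle=\begin{cases}z^{|\nu|-|\mu|},&\nu\prec\mu,\\0,&\text{otherwise,}\end{cases}\qquad \langle\mu|\Gamma_-(z)|\nu\rangle=\begin{cases}z^{|\mu|-|\nu|},&\nu\prec\mu,\\0,&\text{otherwise.}\end{cases}$$ -/

import Mathlib

namespace ChargedFermion

/-- A finite-energy Maya diagram, given by the set of sites that carry a black stone: all sites far
to the left carry white stones and all sites far to the right carry black stones. -/
@[ext]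
structure Maya where
  /-- The positions of the black stones. -/
  black : Set ℤ
  bddBelow_black : BddBelow black
  bddAbove_white : BddAbove blackᶜ

namespace Maya

/-- The vacuum: black stones exactly at the sites `0, 1, 2, …`. -/
def vacuum : Maya where
  black := Set.Ici 0
  bddBelow_black := bddBelow_Ici
  bddAbove_white := ⟨0, fun x hx => by simp at hx; omega⟩

/-- Put a white stone at site `m`. -/
def putWhite (M : Maya) (m : ℤ) : Maya where
  black := M.black \ {m}
  bddBelow_black := M.bddBelow_black.mono Set.sdiff_subset
  bddAbove_white := by
    refine (M.bddAbove_white.union (bddAbove_singleton (a := m))).mono ?_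
    intro x hx
    by_cases h : x = m <;> simp_all

/-- Put a black stone at site `m`. -/
def putBlack (M : Maya) (m : ℤ) : Maya where
  black := M.black ∪ {m}
  bddBelow_black := M.bddBelow_black.union bddBelow_singleton
  bddAbove_white := M.bddAbove_white.mono
    (Set.compl_subset_compl.2 Set.subset_union_left)

/-- The number of black stones strictly to the left of site `m` (a finite number). -/
noncomputable def blackBelow (M : Maya) (m : ℤ) : ℕ :=
  (M.black ∩ Set.Iio m).ncard

end Maya

/-- The (initial) charged fermion Fock space: the complex vector space whose basis is the set of all
finite-energy Maya diagrams. The basis vector of `M` is `|j₁, j₂, …⟩`, where `j₁ < j₂ < …` are the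
black sites of `M`. -/
abbrev Fock : Type := Maya →₀ ℂ

/-- The basis vector attached to a Maya diagram. -/
noncomputable def basisVec (M : Maya) : Fock := Finsupp.single M 1

open Classical in
/-- `ψ_m |j₁, j₂, …⟩ = (-1)^(k-1) |j₁, …, j_{k-1}, j_{k+1}, …⟩` if `m = j_k`, and `0` if `m` is not
among the `j`'s. -/
noncomputable def psi (m : ℤ) : Module.End ℂ Fock :=
  Finsupp.linearCombination ℂ fun M : Maya =>
    if m ∈ M.black then (-1 : ℂ) ^ M.blackBelow m • basisVec (M.putWhite m) else 0

open Classical in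
/-- `ψ*_m |j₁, j₂, …⟩ = (-1)^k |j₁, …, j_k, m, j_{k+1}, …⟩` if `j_k < m < j_{k+1}`, and `0` if `m` is
among the `j`'s. -/
noncomputable def psiStar (m : ℤ) : Module.End ℂ Fock :=
  Finsupp.linearCombination ℂ fun M : Maya =>
    if m ∈ M.black then 0 else (-1 : ℂ) ^ M.blackBelow m • basisVec (M.putBlack m)

/-- The vacuum vector `|0⟩`. -/
noncomputable def vacKet : Fock := basisVec Maya.vacuum

/-- The dual vacuum vector `⟨0|`, as a functional on the Fock space: it takes the value `1` at `|0⟩`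
and `0` at every other basis vector. Operators act on functionals from the right, by
precomposition. -/
noncomputable def vacBra : Module.Dual ℂ Fock := Finsupp.lapply Maya.vacuum

/-- The normal-ordered product `:ψ_i ψ*_j: = ψ_i ψ*_j - ⟨0|ψ_i ψ*_j|0⟩`. -/
noncomputable def normalOrdered (i j : ℤ) : Module.End ℂ Fock :=
  psi i * psiStar j - vacBra ((psi i * psiStar j) vacKet) • (1 : Module.End ℂ Fock)

/-- `H_m = ∑_{j ∈ ℤ} :ψ_j ψ*_{j+m}:`. On each basis vector only finitely many of the summands are
nonzero (see `finite_support_normalOrdered`). -/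
noncomputable def heis (m : ℤ) : Module.End ℂ Fock :=
  Finsupp.linearCombination ℂ fun M : Maya => ∑ᶠ j : ℤ, normalOrdered j (j + m) (basisVec M)

theorem psiStar_basisVec_of_mem {M : Maya} {m : ℤ} (h : m ∈ M.black) :
    psiStar m (basisVec M) = 0 := by
  simp [psiStar, basisVec, h]

theorem psi_psiStar_basisVec_of_notMem {M : Maya} {m i : ℤ} (hm : m ∉ M.black)
    (hi : i ∉ M.black) :
    psi i (psiStar m (basisVec M)) = if i = m then basisVec M else 0 := by
  by_cases him : i = m
  · subst him
    have h1 : (M.putBlack i).putWhite i = M := by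
      ext x
      by_cases hx : x = i <;> simp_all [Maya.putBlack, Maya.putWhite]
    have h2 : (M.putBlack i).blackBelow i = M.blackBelow i := by
      unfold Maya.blackBelow
      congr 1
      ext x
      simp only [Maya.putBlack, Set.mem_inter_iff, Set.mem_union, Set.mem_singleton_iff,
        Set.mem_Iio]
      constructor
      · rintro ⟨h | h, h'⟩
        · exact ⟨h, h'⟩
        · omega
      · rintro ⟨h, h'⟩
        exact ⟨Or.inl h, h'⟩
    have h3 : i ∈ (M.putBlack i).black := by simp [Maya.putBlack]
    have h4 : ((-1 : ℂ) ^ M.blackBelow i) * (-1) ^ M.blackBelow i = 1 := by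
      rw [← mul_pow]
      simp
    simp [psiStar, psi, basisVec, hm, h1, h2, h3, h4]
  · have h3 : i ∉ (M.putBlack m).black := by simp [Maya.putBlack, hi, him]
    simp [psiStar, psi, basisVec, hm, h3, him]

/-- The sum defining `H_m` is finite on each basis vector. -/
theorem finite_support_normalOrdered (m : ℤ) (M : Maya) :
    (Function.support fun j : ℤ => normalOrdered j (j + m) (basisVec M)).Finite := by
  obtain ⟨a, ha⟩ := M.bddBelow_black
  obtain ⟨b, hb⟩ := M.bddAbove_white
  refine (Set.finite_Icc (min (min a (a - m)) (min 0 (-m))) (max (b - m) (-m))).subset ?_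
  intro j hj
  by_contra hout
  apply hj
  simp only [Set.mem_Icc, not_and_or, not_le] at hout
  simp only [normalOrdered, LinearMap.sub_apply, LinearMap.smul_apply, Module.End.mul_apply,
    Module.End.one_apply, vacKet]
  rcases hout with h | h
  · have h1 : j ∉ M.black := fun hx => by have := ha hx; omega
    have h2 : j + m ∉ M.black := fun hx => by have := ha hx; omega
    have h3 : j ∉ Maya.vacuum.black := by simp [Maya.vacuum]; omega
    have h4 : j + m ∉ Maya.vacuum.black := by simp [Maya.vacuum]; omega
    rw [psi_psiStar_basisVec_of_notMem h2 h1, psi_psiStar_basisVec_of_notMem h4 h3]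
    split_ifs <;> simp [vacBra, basisVec]
  · have h1 : j + m ∈ M.black := by
      by_contra hx
      have := hb hx
      omega
    have h2 : j + m ∈ Maya.vacuum.black := by simp [Maya.vacuum]; omega
    rw [psiStar_basisVec_of_mem h1, psiStar_basisVec_of_mem h2]
    simp

/-- The exponential `∑_k A^k / k!` of a formal power series `A` with operator coefficients and
vanishing constant coefficient. For such `A` the power `A^k` has no terms of degree less than `k`,
so the coefficient of degree `n` only involves `k ≤ n`. -/
noncomputable def expSeries (A : PowerSeries (Module.End ℂ Fock)) :
    PowerSeries (Module.End ℂ Fock) :=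
  PowerSeries.mk fun n =>
    ∑ k ∈ Finset.range (n + 1), ((k.factorial : ℂ)⁻¹) • PowerSeries.coeff n (A ^ k)

/-- The vertex operator `Γ₊(z) = exp(-∑_{m ≥ 1} (z^{-m}/m) H_m)`, `z` an indeterminate, as a formal
series in `z⁻¹` with operator coefficients; `gammaPlus d` is the coefficient of `z^d`. The power
series that is exponentiated is in the variable `z⁻¹`. -/
noncomputable def gammaPlus (d : ℤ) : Module.End ℂ Fock :=
  if d ≤ 0 then
    PowerSeries.coeff d.natAbs (expSeries (PowerSeries.mk fun m : ℕ =>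
      if m = 0 then 0 else (-(1 / (m : ℂ))) • heis (m : ℤ)))
  else 0

/-- The vertex operator `Γ₋(z) = exp(-∑_{m ≥ 1} (z^m/m) H_{-m})`, `z` an indeterminate, as a formal
series in `z` with operator coefficients; `gammaMinus d` is the coefficient of `z^d`. -/
noncomputable def gammaMinus (d : ℤ) : Module.End ℂ Fock :=
  if 0 ≤ d then
    PowerSeries.coeff d.natAbs (expSeries (PowerSeries.mk fun m : ℕ =>
      if m = 0 then 0 else (-(1 / (m : ℂ))) • heis (-(m : ℤ))))
  else 0

/-- The number `r` of boxes on the main diagonal, which is the number of hooks. -/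
def hookCount (μ : YoungDiagram) : ℕ := (μ.cells.filter fun c => c.1 = c.2).card

/-- `m_{j+1} = p_{j+1}`: the number of boxes strictly below the `(j+1)`-st diagonal box in its
column (used for `j < hookCount μ`). -/
def mCoord (μ : YoungDiagram) (j : ℕ) : ℕ := μ.colLen j - (j + 1)

/-- `n_{j+1} = -q_{j+1}`, where `q_{j+1}` is the number of boxes of the `(j+1)`-st row that lie
weakly to the right of the diagonal box (used for `j < hookCount μ`). -/
def nCoord (μ : YoungDiagram) (j : ℕ) : ℤ := -((μ.rowLen j : ℤ) - j)

/-- `κ = ∑_{k=1}^r (m_k + k)`. -/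
def kappa (μ : YoungDiagram) : ℕ := ∑ j ∈ Finset.range (hookCount μ), (mCoord μ j + (j + 1))

/-- The initial state vector
`|μ⟩ = (-1)^κ ψ_{m_1} ⋯ ψ_{m_r} ψ*_{n_1} ⋯ ψ*_{n_r} |0⟩`. -/
noncomputable def ket (μ : YoungDiagram) : Fock :=
  (-1 : ℂ) ^ kappa μ •
    ((((List.range (hookCount μ)).map fun j => psi (mCoord μ j)).prod *
      ((List.range (hookCount μ)).map fun j => psiStar (nCoord μ j)).prod) vacKet)

/-- The final state vector
`⟨μ| = (-1)^κ ⟨0| ψ_{n_r} ⋯ ψ_{n_1} ψ*_{m_r} ⋯ ψ*_{m_1}`. -/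
noncomputable def bra (μ : YoungDiagram) : Module.Dual ℂ Fock :=
  (-1 : ℂ) ^ kappa μ •
    vacBra.comp
      (((List.range (hookCount μ)).reverse.map fun j => psi (nCoord μ j)).prod *
        ((List.range (hookCount μ)).reverse.map fun j => psiStar (mCoord μ j)).prod)

/-- The matrix element `⟨ν| G(z) |μ⟩` of a formal series `G(z) = ∑_d G_d z^d` of operators: the
formal series in `z`, `z⁻¹` whose coefficient of `z^d` is `⟨ν| G_d |μ⟩`. -/
noncomputable def matrixElement (ν : YoungDiagram) (G : ℤ → Module.End ℂ Fock)
    (μ : YoungDiagram) : ℤ → ℂ :=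
  fun d => bra ν (G d (ket μ))

/-- The monomial `z^n` as a formal series in `z`, `z⁻¹`. -/
def zMonomial (n : ℤ) : ℤ → ℂ := Pi.single n 1

/-- `ν ≺ μ` (`ν` interlaces `μ`): `μ_1 ≥ ν_1 ≥ μ_2 ≥ ν_2 ≥ μ_3 ≥ ⋯`. -/
def Interlaces (ν μ : YoungDiagram) : Prop :=
  ∀ j : ℕ, ν.rowLen j ≤ μ.rowLen j ∧ μ.rowLen (j + 1) ≤ ν.rowLen j

end ChargedFermion

namespace ChargedFermion

/-! The commutator of `H_m` with `ψ*_j` is `-ψ*_{j+m}`. Since `exp(∑ x^m/m) = 1/(1-x)`, conjugating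
`ψ*_j` by `Γ₊(z)` gives `∑_n z^{-n} ψ*_{j+n}`, or recursively `Γ₊ ψ*_j = ψ*_j Γ₊ + z⁻¹ Γ₊ ψ*_{j+1}`
(`gammaPlus_psiStar`). Also, `Γ₊` fixes every vector whose black sites form a half-line.

Let `M` have black sites `f 0 < f 1 < ⋯`. Then `|M⟩ = ψ*_{f 0} |M'⟩`, where `M'` has lost its lowest
stone. The recursion pushes this `ψ*` to the right until it reaches `f 1`, where it annihilates
`|M'⟩`. So the lowest stone lands anywhere in `[f 0, f 1)`, with weight `z^{-1}` per step. By
induction on the number of stones before the consecutive tail, `Γ₊|M⟩` is the weighted sum of all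
`g` with `f i ≤ g i < f (i+1)` (`gammaPlus_apply_of_range`).

The sign `(-1)^κ` makes `|μ⟩` exactly the basis vector with black sites `i - μ_i`, `i ≥ 0`
(`exists_ket_eq_basisVec`). For `f i = i - μ_i` and `g i = i - ν_i` the inequalities above become `ν
≺ μ`. The statement for `Γ₋` follows by transposition, which exchanges `ψ_m` with `ψ*_m`, `H_m` with
`H_{-m}`, and `|μ⟩` with `⟨μ|`. -/

/-! ### Basis vectors and counting stones -/

theorem end_ext {X Y : Module.End ℂ Fock} (h : ∀ M, X (basisVec M) = Y (basisVec M)) : X = Y :=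
  Finsupp.lhom_ext' fun M => LinearMap.ext_ring (h M)

theorem basisVec_apply (M N : Maya) [Decidable (M = N)] :
    basisVec M N = if M = N then 1 else 0 := by
  simp only [basisVec, Finsupp.single_apply]

open Classical in
theorem psi_basisVec (m : ℤ) (M : Maya) :
    psi m (basisVec M) =
      if m ∈ M.black then (-1 : ℂ) ^ M.blackBelow m • basisVec (M.putWhite m) else 0 := by
  simp [psi, basisVec]

open Classical in
theorem psiStar_basisVec (m : ℤ) (M : Maya) :
    psiStar m (basisVec M) =
      if m ∈ M.black then 0 else (-1 : ℂ) ^ M.blackBelow m • basisVec (M.putBlack m) := by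
  simp [psiStar, basisVec]

namespace Maya

theorem mem_putWhite {M : Maya} {m x : ℤ} : x ∈ (M.putWhite m).black ↔ x ∈ M.black ∧ x ≠ m :=
  Iff.rfl

theorem mem_putBlack {M : Maya} {m x : ℤ} : x ∈ (M.putBlack m).black ↔ x ∈ M.black ∨ x = m :=
  Iff.rfl

theorem mem_vacuum {x : ℤ} : x ∈ vacuum.black ↔ 0 ≤ x := Iff.rfl

theorem finite_black_inter_Iio (M : Maya) (m : ℤ) : (M.black ∩ Set.Iio m).Finite := by
  obtain ⟨a, ha⟩ := M.bddBelow_black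
  exact (Set.finite_Ico a m).subset fun x hx => ⟨ha hx.1, hx.2⟩

theorem putWhite_putBlack {M : Maya} {m : ℤ} (h : m ∉ M.black) :
    (M.putBlack m).putWhite m = M := by
  ext x
  by_cases hx : x = m <;> simp_all [mem_putBlack, mem_putWhite]

theorem putBlack_putWhite {M : Maya} {m : ℤ} (h : m ∈ M.black) :
    (M.putWhite m).putBlack m = M := by
  ext x
  by_cases hx : x = m <;> simp_all [mem_putBlack, mem_putWhite]

theorem putBlack_comm (M : Maya) (i j : ℤ) :
    (M.putBlack i).putBlack j = (M.putBlack j).putBlack i := by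
  ext x
  simp only [mem_putBlack]
  tauto

theorem putWhite_putBlack_comm (M : Maya) {i j : ℤ} (h : i ≠ j) :
    (M.putBlack i).putWhite j = (M.putWhite j).putBlack i := by
  ext x
  simp only [mem_putBlack, mem_putWhite]
  by_cases hx : x = i <;> simp_all

theorem blackBelow_putBlack_of_le (M : Maya) {b x : ℤ} (h : x ≤ b) :
    (M.putBlack b).blackBelow x = M.blackBelow x := by
  unfold blackBelow
  congr 1
  ext y
  simp only [Set.mem_inter_iff, mem_putBlack, Set.mem_Iio]
  constructor
  · rintro ⟨h1 | h1, h2⟩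
    · exact ⟨h1, h2⟩
    · omega
  · rintro ⟨h1, h2⟩
    exact ⟨Or.inl h1, h2⟩

theorem blackBelow_putBlack_of_lt {M : Maya} {b x : ℤ} (hb : b ∉ M.black) (h : b < x) :
    (M.putBlack b).blackBelow x = M.blackBelow x + 1 := by
  unfold blackBelow
  rw [← Set.ncard_insert_of_notMem (a := b) (fun hx => hb hx.1) (M.finite_black_inter_Iio x)]
  congr 1
  ext y
  simp only [Set.mem_inter_iff, mem_putBlack, Set.mem_Iio, Set.mem_insert_iff]
  constructor
  · rintro ⟨h1 | h1, h2⟩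
    · exact Or.inr ⟨h1, h2⟩
    · exact Or.inl h1
  · rintro (rfl | ⟨h1, h2⟩)
    · exact ⟨Or.inr rfl, h⟩
    · exact ⟨Or.inl h1, h2⟩

theorem blackBelow_putWhite_of_le (M : Maya) {b x : ℤ} (h : x ≤ b) :
    (M.putWhite b).blackBelow x = M.blackBelow x := by
  by_cases hb : b ∈ M.black
  · rw [← blackBelow_putBlack_of_le (M.putWhite b) h, putBlack_putWhite hb]
  · congr 1
    ext y
    rw [mem_putWhite]
    exact ⟨fun hy => hy.1, fun hy => ⟨hy, fun he => hb (he ▸ hy)⟩⟩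

theorem blackBelow_putWhite_of_lt {M : Maya} {b x : ℤ} (hb : b ∈ M.black) (h : b < x) :
    M.blackBelow x = (M.putWhite b).blackBelow x + 1 := by
  rw [← blackBelow_putBlack_of_lt (fun hx => (mem_putWhite.1 hx).2 rfl) h, putBlack_putWhite hb]

theorem blackBelow_eq_zero {M : Maya} {x : ℤ} (h : ∀ y ∈ M.black, x ≤ y) : M.blackBelow x = 0 := by
  unfold blackBelow
  rw [Set.ncard_eq_zero (M.finite_black_inter_Iio x)]
  ext y
  simp only [Set.mem_inter_iff, Set.mem_Iio, Set.mem_empty_iff_false, iff_false, not_and, not_lt]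
  exact h y

end Maya

/-! ### Canonical anticommutation relations -/

theorem psiStar_psiStar_of_lt {i j : ℤ} (h : i < j) (v : Fock) :
    psiStar i (psiStar j v) = -psiStar j (psiStar i v) := by
  suffices psiStar i * psiStar j = -(psiStar j * psiStar i) from LinearMap.congr_fun this v
  refine end_ext fun M => ?_
  simp only [Module.End.mul_apply, LinearMap.neg_apply, psiStar_basisVec]
  by_cases hi : i ∈ M.black <;> by_cases hj : j ∈ M.black <;>
    simp only [hi, hj, if_true, if_false, map_zero, map_smul, psiStar_basisVec, Maya.mem_putBlack,
      h.ne, h.ne', or_false, smul_zero, neg_zero]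
  rw [Maya.blackBelow_putBlack_of_le M h.le, Maya.blackBelow_putBlack_of_lt hi h,
    Maya.putBlack_comm, smul_smul, smul_smul, ← neg_smul]
  ring_nf

theorem psiStar_psiStar_self (i : ℤ) (v : Fock) : psiStar i (psiStar i v) = 0 := by
  suffices psiStar i * psiStar i = 0 from LinearMap.congr_fun this v
  refine end_ext fun M => ?_
  by_cases hi : i ∈ M.black <;> simp [psiStar_basisVec, Maya.mem_putBlack, hi]

/-- The operators `ψ*` anticommute. -/
theorem psiStar_psiStar (i j : ℤ) (v : Fock) :
    psiStar i (psiStar j v) = -psiStar j (psiStar i v) := by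
  rcases lt_trichotomy i j with h | rfl | h
  · exact psiStar_psiStar_of_lt h v
  · simp [psiStar_psiStar_self]
  · rw [psiStar_psiStar_of_lt h, neg_neg]

/-- The canonical anticommutation relation between `ψ` and `ψ*`. -/
theorem psiStar_psi (i j : ℤ) (v : Fock) :
    psiStar j (psi i v) = (if i = j then v else 0) - psi i (psiStar j v) := by
  suffices psiStar j * psi i = (if i = j then 1 else 0) - psi i * psiStar j by
    refine (LinearMap.congr_fun this v).trans ?_
    rw [LinearMap.sub_apply]
    split_ifs <;> rfl
  have hs (k : ℕ) (v : Fock) : (-1 : ℂ) ^ k • (-1 : ℂ) ^ k • v = v := by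
    rw [smul_smul, ← mul_pow]
    simp
  refine end_ext fun M => ?_
  by_cases hij : i = j
  · subst hij
    by_cases hi : i ∈ M.black
    · simp only [Module.End.mul_apply, LinearMap.sub_apply, psiStar_basisVec, psi_basisVec, hi,
        if_true, map_zero, map_smul, Maya.mem_putWhite, Maya.putBlack_putWhite hi,
        Maya.blackBelow_putWhite_of_le M le_rfl, Module.End.one_apply]
      simp [hs]
    · simp only [Module.End.mul_apply, LinearMap.sub_apply, psiStar_basisVec, psi_basisVec, hi,
        if_true, if_false, map_zero, map_smul, Maya.mem_putBlack, Maya.putWhite_putBlack hi,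
        Maya.blackBelow_putBlack_of_le M le_rfl, Module.End.one_apply]
      simp [hs]
  · simp only [Module.End.mul_apply, LinearMap.sub_apply, hij, if_false, LinearMap.zero_apply,
      zero_sub, psiStar_basisVec, psi_basisVec]
    by_cases hi : i ∈ M.black <;> by_cases hj : j ∈ M.black <;>
      simp only [hi, hj, hij, Ne.symm hij, if_true, if_false, map_zero, map_smul, psiStar_basisVec,
        psi_basisVec, Maya.mem_putBlack, Maya.mem_putWhite, ne_eq, not_false_eq_true,
        and_true, or_false, smul_zero, neg_zero]
    rw [Maya.putWhite_putBlack_comm M (Ne.symm hij), smul_smul, smul_smul, ← neg_smul]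
    congr 1
    -- Only the operator acting at the smaller site changes the count seen by the other, so the two
    -- orders differ by one sign.
    rcases lt_or_gt_of_ne hij with h | h
    · rw [Maya.blackBelow_putBlack_of_le M h.le, Maya.blackBelow_putWhite_of_lt hi h]
      ring
    · rw [Maya.blackBelow_putBlack_of_lt hj h, Maya.blackBelow_putWhite_of_le M h.le]
      ring

/-! ### The operators `H_m` and their commutators with `ψ*_j` -/

theorem normalOrdered_apply (i k : ℤ) (v : Fock) :
    normalOrdered i k v = psi i (psiStar k v) - vacBra (psi i (psiStar k vacKet)) • v := rfl

/-- Moving `ψ*_j` to the left past two fermions costs two signs, which cancel. Only the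
anticommutator of `ψ_i` with `ψ*_j` remains, and the scalar subtracted by normal ordering commutes
with everything. -/
theorem normalOrdered_psiStar (i k j : ℤ) (v : Fock) :
    normalOrdered i k (psiStar j v) = psiStar j (normalOrdered i k v) -
      if i = j then psiStar k v else 0 := by
  rw [normalOrdered_apply, normalOrdered_apply, psiStar_psiStar, map_neg, map_sub, psiStar_psi,
    map_smul]
  abel

theorem finite_support_normalOrdered_apply (m : ℤ) (v : Fock) :
    (Function.support fun j : ℤ => normalOrdered j (j + m) v).Finite := by
  induction v using Finsupp.induction_linear with
  | zero => simp
  | add u v hu hv =>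
    refine (hu.union hv).subset ?_
    simp only [map_add]
    exact Function.support_add _ _
  | single M c =>
    refine (finite_support_normalOrdered m M).subset fun j hj hM => hj ?_
    have : (Finsupp.single M c : Fock) = c • basisVec M := by simp [basisVec]
    simp only at hM
    simp only [this, map_smul, hM, smul_zero]

/-- The sum defining `H_m` may be evaluated at any vector. -/
theorem heis_apply (m : ℤ) (v : Fock) : heis m v = ∑ᶠ j : ℤ, normalOrdered j (j + m) v := by
  induction v using Finsupp.induction_linear with
  | zero => simp
  | add u v hu hv =>
    rw [map_add, hu, hv, ← finsum_add_distrib (finite_support_normalOrdered_apply m u)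
      (finite_support_normalOrdered_apply m v)]
    simp only [map_add]
  | single M c =>
    have : (Finsupp.single M c : Fock) = c • basisVec M := by simp [basisVec]
    simp only [this, map_smul]
    rw [← smul_finsum' c (finite_support_normalOrdered m M)]
    simp [heis, basisVec]

theorem heis_psiStar (m j : ℤ) (v : Fock) :
    heis m (psiStar j v) = psiStar j (heis m v) - psiStar (j + m) v := by
  rw [heis_apply, heis_apply]
  have h : ∀ i, normalOrdered i (i + m) (psiStar j v) =
      psiStar j (normalOrdered i (i + m) v) - if i = j then psiStar (j + m) v else 0 := by
    intro i
    rw [normalOrdered_psiStar]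
    congr 1
    split_ifs with hij
    · rw [hij]
    · rfl
  have hf := finite_support_normalOrdered_apply m v
  simp only [h]
  rw [finsum_sub_distrib, finsum_eq_single _ j (fun i hi => if_neg hi), if_pos rfl]
  · congr 1
    exact ((psiStar j).toAddMonoidHom.map_finsum hf).symm
  · refine hf.subset fun i hi h0 => hi ?_
    simp only at h0
    simp only [h0, map_zero]
  · refine (Set.finite_singleton j).subset fun i hi => ?_
    by_contra hne
    exact hi (if_neg hne)

/-- If `j + m` is white in a half-line configuration and `m > 0`, then `j` is also white and differs
from `j + m`, so `ψ_j ψ*_{j+m}` vanishes there. Applied to the vacuum, this also removes the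
normal-ordering constant. -/
theorem heis_basisVec_eq_zero {m : ℤ} (hm : 0 < m) {M : Maya} {c : ℤ}
    (hM : M.black = Set.Ici c) : heis m (basisVec M) = 0 := by
  have key : ∀ (N : Maya) (b : ℤ), N.black = Set.Ici b → ∀ j,
      psi j (psiStar (j + m) (basisVec N)) = 0 := by
    intro N b hN j
    by_cases h : j + m ∈ N.black
    · rw [psiStar_basisVec_of_mem h, map_zero]
    · rw [psi_psiStar_basisVec_of_notMem h, if_neg (by omega)]
      rw [hN, Set.mem_Ici] at h ⊢
      omega
  rw [heis_apply]
  refine finsum_eq_zero_of_forall_eq_zero fun j => ?_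
  simp [normalOrdered, key M c hM, vacKet, key Maya.vacuum 0 rfl]

/-! ### Conjugation by the exponential of a formal series -/

theorem coeff_pow_eq_zero_of_lt {R : Type*} [Semiring R] {A : PowerSeries R}
    (hA : PowerSeries.coeff 0 A = 0) :
    ∀ {k n : ℕ}, n < k → PowerSeries.coeff n (A ^ k) = 0
  | k + 1, n, h => by
    rw [pow_succ, PowerSeries.coeff_mul]
    refine Finset.sum_eq_zero fun p hp => ?_
    rw [Finset.HasAntidiagonal.mem_antidiagonal] at hp
    rcases Nat.eq_zero_or_pos p.2 with h0 | h0
    · rw [h0, hA, mul_zero]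
    · rw [coeff_pow_eq_zero_of_lt hA (by omega : p.1 < k), zero_mul]

/-- The power series `∑_{m ≥ 1} x^m / m = -log (1 - x)`. -/
noncomputable def negLogOneSub : PowerSeries ℂ := PowerSeries.mk fun m => (m : ℂ)⁻¹

/-- The coefficients of `exp (-log (1 - x)) = 1 / (1 - x)`. -/
theorem sum_coeff_negLogOneSub_pow (n : ℕ) :
    ∑ k ∈ Finset.range (n + 1),
      ((k.factorial : ℂ)⁻¹) * PowerSeries.coeff n (negLogOneSub ^ k) = 1 := by
  have h0 : PowerSeries.coeff 0 negLogOneSub = 0 := by simp [negLogOneSub]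
  have hd : PowerSeries.derivative ℂ negLogOneSub = PowerSeries.mk fun _ => 1 := by
    ext m
    rw [PowerSeries.coeff_derivative]
    simp only [negLogOneSub, PowerSeries.coeff_mk]
    push_cast
    exact inv_mul_cancel₀ (Nat.cast_add_one_ne_zero m)
  induction n using Nat.strong_induction_on with
  | _ n ih =>
    rcases n with _ | n
    · simp
    have hn : ((n : ℂ) + 1) ≠ 0 := Nat.cast_add_one_ne_zero n
    -- This compares coefficients in `(L^{k+1}/(k+1)!)' = (L^k/k!) · 1/(1-x)`. Summed over `k`, it
    -- gives `n + 1` inner sums, each equal to 1 by induction.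
    have hstep (k : ℕ) : (((k + 1).factorial : ℂ)⁻¹) *
        PowerSeries.coeff (n + 1) (negLogOneSub ^ (k + 1)) * (n + 1) =
        ∑ a ∈ Finset.range (n + 1),
          ((k.factorial : ℂ)⁻¹) * PowerSeries.coeff a (negLogOneSub ^ k) := by
      rw [mul_assoc, ← PowerSeries.coeff_derivative, PowerSeries.derivative_pow, hd,
        PowerSeries.coeff_mul, Finset.Nat.sum_antidiagonal_eq_sum_range_succ_mk, Finset.mul_sum]
      refine Finset.sum_congr rfl fun a _ => ?_
      have hk : ((k : ℂ) + 1) ≠ 0 := Nat.cast_add_one_ne_zero k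
      have hk' : (k.factorial : ℂ) ≠ 0 := Nat.cast_ne_zero.2 k.factorial_ne_zero
      rw [PowerSeries.coeff_mk, mul_one, Nat.add_sub_cancel, ← map_natCast (PowerSeries.C (R := ℂ)),
        PowerSeries.coeff_C_mul, Nat.factorial_succ]
      push_cast
      field_simp
    rw [Finset.sum_range_succ', ← mul_left_inj' hn, add_mul, Finset.sum_mul, Finset.sum_congr rfl
      fun k _ => hstep k, Finset.sum_comm]
    have hin : ∀ a ∈ Finset.range (n + 1), ∑ k ∈ Finset.range (n + 1),
        ((k.factorial : ℂ)⁻¹) * PowerSeries.coeff a (negLogOneSub ^ k) = 1 := by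
      intro a ha
      rw [Finset.mem_range] at ha
      rw [← ih a ha]
      refine (Finset.sum_subset (Finset.range_subset_range.2 (by omega)) fun k _ hk => ?_).symm
      rw [coeff_pow_eq_zero_of_lt h0 (by rw [Finset.mem_range] at hk; omega), mul_zero]
    rw [Finset.sum_congr rfl hin]
    simp [PowerSeries.coeff_one]

/-- The series `∑_n p_n x^n ψ*_{j+n}` for a scalar series `p = ∑_n p_n x^n`. -/
noncomputable def psiStarSeries (p : PowerSeries ℂ) (j : ℤ) : PowerSeries (Module.End ℂ Fock) :=
  PowerSeries.mk fun n => PowerSeries.coeff n p • psiStar (j + n)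

/-- Under `hA`, the commutator with `A` acts on these series as multiplication of the scalar symbol
by `L`. -/
theorem mul_psiStarSeries {A : PowerSeries (Module.End ℂ Fock)} {L : PowerSeries ℂ}
    (hA : ∀ m j, PowerSeries.coeff m A * psiStar j =
      psiStar j * PowerSeries.coeff m A + PowerSeries.coeff m L • psiStar (j + m))
    (p : PowerSeries ℂ) (j : ℤ) :
    A * psiStarSeries p j = psiStarSeries p j * A + psiStarSeries (L * p) j := by
  ext1 n
  rw [map_add, PowerSeries.coeff_mul, PowerSeries.coeff_mul, ← Finset.Nat.sum_antidiagonal_swap]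
  simp only [psiStarSeries, PowerSeries.coeff_mk]
  rw [mul_comm L p, PowerSeries.coeff_mul, Finset.sum_smul, ← Finset.sum_add_distrib]
  refine Finset.sum_congr rfl fun x hx => ?_
  rw [Finset.HasAntidiagonal.mem_antidiagonal] at hx
  rw [Prod.fst_swap, Prod.snd_swap, mul_smul_comm, hA, smul_add, smul_mul_assoc, smul_smul,
    ← hx, add_assoc, Nat.cast_add]

/-- Left multiplication by `A` is the sum of right multiplication by `A` and multiplication of the
symbol by `L`. These commute, so the binomial theorem applies. -/
theorem pow_mul_psiStarSeries {A : PowerSeries (Module.End ℂ Fock)} {L : PowerSeries ℂ}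
    (hA : ∀ m j, PowerSeries.coeff m A * psiStar j =
      psiStar j * PowerSeries.coeff m A + PowerSeries.coeff m L • psiStar (j + m))
    (k : ℕ) (j : ℤ) :
    A ^ k * psiStarSeries 1 j =
      ∑ x ∈ Finset.HasAntidiagonal.antidiagonal k, k.choose x.1 • (psiStarSeries (L ^ x.1) j * A ^ x.2) := by
  induction k with
  | zero => simp
  | succ k ih =>
    rw [Finset.sum_antidiagonal_choose_succ_nsmul
      (fun a b => psiStarSeries (L ^ a) j * A ^ b), pow_succ', mul_assoc, ih, Finset.mul_sum,
      ← Finset.sum_add_distrib]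
    refine Finset.sum_congr rfl fun x hx => ?_
    rw [Finset.HasAntidiagonal.mem_antidiagonal] at hx
    have hc : k.choose x.2 = k.choose x.1 := by
      rw [← hx]; exact (Nat.choose_symm_add).symm
    rw [hc, mul_smul_comm, ← mul_assoc, mul_psiStarSeries hA, add_mul, smul_add, mul_assoc,
      ← pow_succ', ← pow_succ']

theorem coeff_expSeries_eq_sum_range {A : PowerSeries (Module.End ℂ Fock)}
    (hA : PowerSeries.coeff 0 A = 0) {n K : ℕ} (h : n < K) :
    PowerSeries.coeff n (expSeries A) =
      ∑ k ∈ Finset.range K, ((k.factorial : ℂ)⁻¹) • PowerSeries.coeff n (A ^ k) := by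
  rw [expSeries, PowerSeries.coeff_mk]
  refine Finset.sum_subset (Finset.range_subset_range.2 (by omega)) fun k _ hk => ?_
  rw [coeff_pow_eq_zero_of_lt hA (by rw [Finset.mem_range] at hk; omega), smul_zero]

/-- Summing over the pairs `(i, l)` with `i + l ≤ n` or over a box makes no difference, for a
function that vanishes where `i + l > n`. -/
theorem sum_range_antidiagonal {E : Type*} [AddCommMonoid E] (g : ℕ → ℕ → E) {n a b : ℕ}
    (hab : a + b = n) (hg : ∀ i l, a < i ∨ b < l → g i l = 0) :
    ∑ k ∈ Finset.range (n + 1), ∑ x ∈ Finset.HasAntidiagonal.antidiagonal k, g x.1 x.2 =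
      ∑ i ∈ Finset.range (a + 1), ∑ l ∈ Finset.range (b + 1), g i l := by
  rw [← Finset.sum_product', Finset.sum_sigma']
  symm
  refine Finset.sum_of_injOn (fun x : ℕ × ℕ => (⟨x.1 + x.2, x⟩ : (_ : ℕ) × ℕ × ℕ)) ?_ ?_ ?_ ?_
  · intro x _ y _ h
    simpa using (Sigma.mk.inj_iff.1 h).2
  · intro x hx
    simp only [Finset.coe_product, Set.mem_prod, Finset.coe_range, Set.mem_Iio] at hx
    simp only [Finset.coe_sigma, Set.mem_sigma_iff, Finset.coe_range, Set.mem_Iio,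
      Finset.mem_coe, Finset.HasAntidiagonal.mem_antidiagonal, and_true]
    omega
  · rintro ⟨k, i, l⟩ hx hnot
    simp only [Finset.mem_sigma, Finset.mem_range, Finset.HasAntidiagonal.mem_antidiagonal] at hx
    refine hg _ _ ?_
    by_contra hcon
    refine hnot ⟨(i, l), ?_, ?_⟩
    · dsimp only at hx hcon
      simp only [Finset.coe_product, Set.mem_prod, Finset.coe_range, Set.mem_Iio]
      omega
    · simp [hx.2]
  · intro x _
    rfl

/-- This is `e^A ψ*_j e^{-A} = ∑_n x^n ψ*_{j+n}` with `e^A` kept on the right, so no inverse is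
needed. The scalar series is `e^L = 1/(1-x)`. -/
theorem coeff_expSeries_mul_psiStar {A : PowerSeries (Module.End ℂ Fock)}
    (h0 : PowerSeries.coeff 0 A = 0)
    (hA : ∀ m j, PowerSeries.coeff m A * psiStar j =
      psiStar j * PowerSeries.coeff m A + PowerSeries.coeff m negLogOneSub • psiStar (j + m))
    (n : ℕ) (j : ℤ) :
    PowerSeries.coeff n (expSeries A) * psiStar j =
      ∑ x ∈ Finset.HasAntidiagonal.antidiagonal n,
        psiStar (j + x.1) * PowerSeries.coeff x.2 (expSeries A) := by
  have hL0 : PowerSeries.coeff 0 negLogOneSub = 0 := by simp [negLogOneSub]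
  have h1 : psiStarSeries 1 j = PowerSeries.C (psiStar j) := by
    ext1 m
    rw [psiStarSeries, PowerSeries.coeff_mk, PowerSeries.coeff_one, PowerSeries.coeff_C]
    split_ifs with h
    · simp [h]
    · simp
  have hk (k : ℕ) : ((k.factorial : ℂ)⁻¹ • PowerSeries.coeff n (A ^ k)) * psiStar j =
      ∑ y ∈ Finset.HasAntidiagonal.antidiagonal n, ∑ x ∈ Finset.HasAntidiagonal.antidiagonal k,
        (((x.1.factorial : ℂ)⁻¹) * PowerSeries.coeff y.1 (negLogOneSub ^ x.1)) •
          (psiStar (j + y.1) *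
            (((x.2.factorial : ℂ)⁻¹) • PowerSeries.coeff y.2 (A ^ x.2))) := by
    rw [smul_mul_assoc, ← PowerSeries.coeff_mul_C, ← h1, pow_mul_psiStarSeries hA, map_sum,
      Finset.smul_sum, Finset.sum_comm]
    refine Finset.sum_congr rfl fun x hx => ?_
    rw [Finset.HasAntidiagonal.mem_antidiagonal] at hx
    rw [map_nsmul, PowerSeries.coeff_mul, Finset.smul_sum, Finset.smul_sum]
    refine Finset.sum_congr rfl fun y _ => ?_
    rw [psiStarSeries, PowerSeries.coeff_mk, smul_mul_assoc, mul_smul_comm, smul_smul,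
      ← Nat.cast_smul_eq_nsmul ℂ, smul_smul, smul_smul]
    congr 1
    -- The binomial coefficient over `k!` splits as `1/(i! l!)`, which is what separates the two
    -- exponentials.
    have h := Nat.add_choose_mul_factorial_mul_factorial x.1 x.2
    rw [← Nat.choose_symm_add, hx] at h
    have e1 : (x.1.factorial : ℂ) ≠ 0 := Nat.cast_ne_zero.2 (Nat.factorial_ne_zero _)
    have e2 : (x.2.factorial : ℂ) ≠ 0 := Nat.cast_ne_zero.2 (Nat.factorial_ne_zero _)
    have e3 : (k.factorial : ℂ) ≠ 0 := Nat.cast_ne_zero.2 (Nat.factorial_ne_zero _)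
    have h' : (k.choose x.1 : ℂ) * x.1.factorial * x.2.factorial = k.factorial := by
      exact_mod_cast h
    field_simp
    rw [← h']
    ring
  rw [coeff_expSeries_eq_sum_range h0 (Nat.lt_succ_self n), Finset.sum_mul, Finset.sum_congr rfl
    fun k _ => hk k, Finset.sum_comm]
  refine Finset.sum_congr rfl fun y hy => ?_
  rw [Finset.HasAntidiagonal.mem_antidiagonal] at hy
  -- Terms with `i` or `l` above the corresponding degree vanish, so the sum over `i + l = k`
  -- becomes a product of two independent sums.
  rw [sum_range_antidiagonal (fun i l =>
    (((i.factorial : ℂ)⁻¹) * PowerSeries.coeff y.1 (negLogOneSub ^ i)) •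
          (psiStar (j + y.1) *
            (((l.factorial : ℂ)⁻¹) • PowerSeries.coeff y.2 (A ^ l)))) hy]
  · simp only [← Finset.smul_sum, ← Finset.mul_sum]
    rw [← Finset.sum_smul, sum_coeff_negLogOneSub_pow, one_smul,
      coeff_expSeries_eq_sum_range h0 (Nat.lt_succ_self y.2)]
  · rintro i l (h | h)
    · rw [coeff_pow_eq_zero_of_lt hL0 h, mul_zero, zero_smul]
    · rw [coeff_pow_eq_zero_of_lt h0 h, smul_zero, mul_zero, smul_zero]

/-! ### Commuting `Γ₊` past `ψ*_j` -/

/-- The exponent of `Γ₊`, as a power series in `z⁻¹`. -/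
noncomputable def gammaPlusExponent : PowerSeries (Module.End ℂ Fock) :=
  PowerSeries.mk fun m : ℕ => if m = 0 then 0 else (-(1 / (m : ℂ))) • heis (m : ℤ)

theorem coeff_zero_gammaPlusExponent : PowerSeries.coeff 0 gammaPlusExponent = 0 := by
  simp [gammaPlusExponent]

/-- The minus sign in the exponent cancels the one in the commutator of `H_m` with `ψ*_j`. -/
theorem coeff_gammaPlusExponent_mul_psiStar (m : ℕ) (j : ℤ) :
    PowerSeries.coeff m gammaPlusExponent * psiStar j =
      psiStar j * PowerSeries.coeff m gammaPlusExponent +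
        PowerSeries.coeff m negLogOneSub • psiStar (j + m) := by
  refine LinearMap.ext fun v => ?_
  rw [gammaPlusExponent, negLogOneSub, PowerSeries.coeff_mk, PowerSeries.coeff_mk]
  by_cases hm : m = 0
  · simp [hm]
  · simp only [hm, if_false, Module.End.mul_apply, LinearMap.add_apply, LinearMap.smul_apply,
      heis_psiStar, map_smul]
    rw [smul_sub, one_div, neg_smul, neg_smul, sub_neg_eq_add]

theorem gammaPlus_neg_natCast (n : ℕ) :
    gammaPlus (-(n : ℤ)) = PowerSeries.coeff n (expSeries gammaPlusExponent) := by
  simp [gammaPlus, gammaPlusExponent]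

/-- The commutation relation `Γ₊(z) ψ*_j = ψ*_j Γ₊(z) + z⁻¹ Γ₊(z) ψ*_{j+1}`. -/
theorem gammaPlus_psiStar (n j : ℤ) (v : Fock) :
    gammaPlus (-n) (psiStar j v) =
      psiStar j (gammaPlus (-n) v) + gammaPlus (-(n - 1)) (psiStar (j + 1) v) := by
  have key (n : ℕ) (j : ℤ) : gammaPlus (-(n : ℤ)) (psiStar j v) =
      ∑ x ∈ Finset.HasAntidiagonal.antidiagonal n, psiStar (j + x.1) (gammaPlus (-(x.2 : ℤ)) v) := by
    have h := LinearMap.congr_fun (coeff_expSeries_mul_psiStar coeff_zero_gammaPlusExponent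
      coeff_gammaPlusExponent_mul_psiStar n j) v
    rw [Module.End.mul_apply, LinearMap.sum_apply] at h
    simp only [gammaPlus_neg_natCast]
    exact h
  rcases lt_or_ge n 0 with hn | hn
  · have h1 : gammaPlus (-n) = 0 := if_neg (by omega)
    have h2 : gammaPlus (-(n - 1)) = 0 := if_neg (by omega)
    rw [h1, h2]
    simp
  lift n to ℕ using hn
  rw [key]
  rcases n with _ | n
  · have h2 : gammaPlus (-(((0 : ℕ) : ℤ) - 1)) = 0 := if_neg (by simp)
    rw [h2]
    simp
  -- Without its first term, the sum is the same formula with `j + 1` and one degree less.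
  · rw [Finset.Nat.sum_antidiagonal_succ]
    have h3 : (((n + 1 : ℕ) : ℤ) - 1) = n := by push_cast; ring
    rw [h3, key]
    simp only [Nat.cast_zero, add_zero]
    congr 1
    refine Finset.sum_congr rfl fun x _ => ?_
    rw [Nat.cast_add, Nat.cast_one, add_assoc, add_comm (1 : ℤ)]

/-- `Γ₊` fixes the vacua of all charges. -/
theorem gammaPlus_basisVec_of_black_eq_Ici {M : Maya} {c : ℤ} (hM : M.black = Set.Ici c) (n : ℤ) :
    gammaPlus (-n) (basisVec M) = if n = 0 then basisVec M else 0 := by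
  rcases lt_or_ge n 0 with hn | hn
  · rw [if_neg hn.ne, gammaPlus, if_neg (by omega), LinearMap.zero_apply]
  lift n to ℕ using hn
  have hA (m : ℕ) : PowerSeries.coeff m gammaPlusExponent (basisVec M) = 0 := by
    rw [gammaPlusExponent, PowerSeries.coeff_mk]
    split_ifs with hm
    · rfl
    · rw [LinearMap.smul_apply, heis_basisVec_eq_zero (by omega) hM, smul_zero]
  have hpow (k m : ℕ) : PowerSeries.coeff m (gammaPlusExponent ^ (k + 1)) (basisVec M) = 0 := by
    rw [pow_succ, PowerSeries.coeff_mul, LinearMap.sum_apply]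
    refine Finset.sum_eq_zero fun x _ => ?_
    rw [Module.End.mul_apply, hA, map_zero]
  rw [gammaPlus_neg_natCast, expSeries, PowerSeries.coeff_mk, LinearMap.sum_apply,
    Finset.sum_range_succ']
  simp only [LinearMap.smul_apply, hpow, smul_zero, Finset.sum_const_zero, zero_add]
  rw [pow_zero, PowerSeries.coeff_one]
  by_cases hn : n = 0 <;> simp [hn]

/-! ### Matrix elements of `Γ₊` between Maya diagrams -/

theorem psiStar_apply (j : ℤ) (v : Fock) (N : Maya) [Decidable (j ∈ N.black)] :
    psiStar j v N =
      if j ∈ N.black then (-1 : ℂ) ^ N.blackBelow j * v (N.putWhite j) else 0 := by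
  classical
  induction v using Finsupp.induction_linear with
  | zero => simp
  | add u v hu hv =>
    rw [map_add, Finsupp.add_apply, hu, hv]
    split_ifs
    · rw [Finsupp.add_apply, mul_add]
    · rw [add_zero]
  | single M c =>
    have hM : (Finsupp.single M c : Fock) = c • basisVec M := by simp [basisVec]
    simp only [hM, map_smul, Finsupp.smul_apply, psiStar_basisVec, smul_eq_mul]
    by_cases hj : j ∈ M.black
    · have hne : M ≠ N.putWhite j := by
        rintro rfl
        exact (Maya.mem_putWhite.1 hj).2 rfl
      simp [hj, basisVec_apply, hne]
    · simp only [hj, if_false, Finsupp.smul_apply, basisVec_apply, smul_eq_mul]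
      by_cases hN : M.putBlack j = N
      · subst hN
        rw [if_pos rfl, if_pos (Maya.mem_putBlack.2 (Or.inr rfl)), Maya.putWhite_putBlack hj,
          if_pos rfl, Maya.blackBelow_putBlack_of_le M le_rfl]
        ring
      · rw [if_neg hN]
        split_ifs with h1 h2
        · exact absurd (by rw [h2, Maya.putBlack_putWhite h1]) hN
        · ring
        · ring

theorem range_eq_Ici {f : ℕ → ℤ} (hf : ∀ i, f (i + 1) = f i + 1) :
    Set.range f = Set.Ici (f 0) := by
  have h (i : ℕ) : f i = f 0 + i := by
    induction i with
    | zero => simp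
    | succ i ih => rw [hf, ih]; push_cast; ring
  ext x
  simp only [Set.mem_range, Set.mem_Ici]
  constructor
  · rintro ⟨i, rfl⟩
    rw [h i]
    omega
  · intro hx
    refine ⟨(x - f 0).toNat, ?_⟩
    rw [h]
    omega

theorem black_putWhite_eq_range {f : ℕ → ℤ} (hf : StrictMono f) {M : Maya}
    (hM : M.black = Set.range f) :
    (M.putWhite (f 0)).black = Set.range fun i => f (i + 1) := by
  ext x
  rw [Maya.mem_putWhite, hM]
  constructor
  · rintro ⟨⟨i, rfl⟩, hne⟩
    rcases i with _ | i
    · exact absurd rfl hne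
    · exact ⟨i, rfl⟩
  · rintro ⟨i, rfl⟩
    exact ⟨⟨i + 1, rfl⟩, (hf (Nat.succ_pos i)).ne'⟩

theorem blackBelow_eq_zero_of_range {f : ℕ → ℤ} (hf : StrictMono f) {M : Maya}
    (hM : M.black = Set.range f) : M.blackBelow (f 0) = 0 := by
  refine Maya.blackBelow_eq_zero fun y hy => ?_
  rw [hM] at hy
  obtain ⟨i, rfl⟩ := hy
  exact hf.monotone (Nat.zero_le i)

/-- The lowest black stone is created by the leftmost factor `ψ*`. -/
theorem psiStar_basisVec_putWhite {f : ℕ → ℤ} (hf : StrictMono f) {M : Maya}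
    (hM : M.black = Set.range f) :
    psiStar (f 0) (basisVec (M.putWhite (f 0))) = basisVec M := by
  have hmem : f 0 ∈ M.black := hM ▸ Set.mem_range_self 0
  rw [psiStar_basisVec, if_neg (fun h => (Maya.mem_putWhite.1 h).2 rfl),
    Maya.blackBelow_putWhite_of_le M le_rfl, blackBelow_eq_zero_of_range hf hM,
    Maya.putBlack_putWhite hmem, pow_zero, one_smul]

/-- `Γ₊` moves black stones to the right only. -/
theorem gammaPlus_apply_eq_zero (K : ℕ) : ∀ (f : ℕ → ℤ) (M N : Maya) (n : ℤ), StrictMono f →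
    M.black = Set.range f → (∀ i, K ≤ i → f (i + 1) = f i + 1) → (∃ x ∈ N.black, x < f 0) →
    gammaPlus (-n) (basisVec M) N = 0 := by
  classical
  induction K with
  | zero =>
    intro f M N n _ hM hK ⟨x, hxN, hx⟩
    rw [range_eq_Ici fun i => hK i (Nat.zero_le i)] at hM
    rw [gammaPlus_basisVec_of_black_eq_Ici hM]
    split_ifs
    · rw [basisVec_apply, if_neg]
      rintro rfl
      rw [hM, Set.mem_Ici] at hxN
      omega
    · rfl
  | succ K ih =>
    intro f M N n hf hM hK ⟨x, hxN, hx⟩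
    have hM' := black_putWhite_eq_range hf hM
    have hmem : f 1 ∈ (M.putWhite (f 0)).black := hM' ▸ ⟨0, rfl⟩
    have h01 : f 0 < f 1 := hf Nat.zero_lt_one
    -- Induction on the distance `d` from `j` to `f 1`, where `ψ*` hits an occupied site and gives
    -- zero.
    have key (d : ℕ) : ∀ n j : ℤ, j + d = f 1 → f 0 ≤ j →
        gammaPlus (-n) (psiStar j (basisVec (M.putWhite (f 0)))) N = 0 := by
      induction d with
      | zero =>
        intro n j hj _
        rw [psiStar_basisVec_of_mem (by rwa [show j = f 1 by simpa using hj]), map_zero,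
          Finsupp.zero_apply]
      | succ d ihd =>
        intro n j hj hj0
        push_cast at hj
        rw [gammaPlus_psiStar, Finsupp.add_apply, ihd (n - 1) (j + 1) (by omega) (by omega),
          add_zero, psiStar_apply]
        split_ifs
        -- Since `x < f 0 ≤ j`, the stone at `x` survives the removal of `j` and still lies left of
        -- `f 1`.
        · rw [ih (fun i => f (i + 1)) _ _ n (fun a b h => hf (by omega)) hM'
            (fun i hi => hK (i + 1) (by omega))
            ⟨x, Maya.mem_putWhite.2 ⟨hxN, by omega⟩, by simp only [zero_add]; omega⟩, mul_zero]
        · rfl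
    have h := key (f 1 - f 0).toNat n (f 0) (by omega) le_rfl
    rwa [psiStar_basisVec_putWhite hf hM] at h

open Classical in
/-- The matrix elements of `Γ₊` between Maya diagrams with black sites `f 0 < f 1 < ⋯` and
`g 0 < g 1 < ⋯`. -/
theorem gammaPlus_apply_of_range (K : ℕ) : ∀ (f g : ℕ → ℤ) (M N : Maya) (n : ℤ), StrictMono f →
    StrictMono g → M.black = Set.range f → N.black = Set.range g → (∀ i, K ≤ i → f i = g i) →
    (∀ i, K ≤ i → f (i + 1) = f i + 1) →
    gammaPlus (-n) (basisVec M) N =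
      if (∀ i, f i ≤ g i ∧ g i < f (i + 1)) ∧ ∑ i ∈ Finset.range K, (g i - f i) = n
        then 1 else 0 := by
  induction K with
  | zero =>
    intro f g M N n hf _ hM hN hfg hK
    obtain rfl : f = g := funext fun i => hfg i (Nat.zero_le i)
    obtain rfl : M = N := Maya.ext (hM.trans hN.symm)
    rw [range_eq_Ici fun i => hK i (Nat.zero_le i)] at hM
    have hcond : ∀ i, f i ≤ f i ∧ f i < f (i + 1) := fun i => ⟨le_rfl, hf (Nat.lt_succ_self i)⟩
    rw [gammaPlus_basisVec_of_black_eq_Ici hM, Finset.range_zero, Finset.sum_empty]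
    by_cases hn : n = 0
    · rw [if_pos hn, if_pos ⟨hcond, hn.symm⟩, basisVec_apply, if_pos rfl]
    · rw [if_neg hn, if_neg (fun h => hn h.2.symm), Finsupp.zero_apply]
  | succ K ih =>
    intro f g M N n hf hg hM hN hfg hK
    have hM' := black_putWhite_eq_range hf hM
    have hN' := black_putWhite_eq_range hg hN
    have hmem : f 1 ∈ (M.putWhite (f 0)).black := hM' ▸ ⟨0, rfl⟩
    have h01 : f 0 < f 1 := hf Nat.zero_lt_one
    have hf' : StrictMono fun i => f (i + 1) := fun a b h => hf (by omega)
    have hg' : StrictMono fun i => g (i + 1) := fun a b h => hg (by omega)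
    -- Here `j` is the current site of the moving lowest stone. At `j = f 1` the conditions `j ≤ g 0
    -- < f 1` are contradictory, matching `ψ*_{f 1}` annihilating the vector.
    have key (d : ℕ) : ∀ n j : ℤ, j + d = f 1 →
        gammaPlus (-n) (psiStar j (basisVec (M.putWhite (f 0)))) N =
          if j ≤ g 0 ∧ g 0 < f 1 ∧ (∀ i, f (i + 1) ≤ g (i + 1) ∧ g (i + 1) < f (i + 1 + 1)) ∧
            (∑ i ∈ Finset.range K, (g (i + 1) - f (i + 1))) + (g 0 - j) = n then 1 else 0 := by
      induction d with
      | zero =>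
        intro n j hj
        rw [psiStar_basisVec_of_mem (by rwa [show j = f 1 by simpa using hj]), map_zero,
          Finsupp.zero_apply, if_neg]
        rintro ⟨h1, h2, -⟩
        push_cast at hj
        omega
      | succ d ihd =>
        intro n j hj
        push_cast at hj
        rw [gammaPlus_psiStar, Finsupp.add_apply, ihd (n - 1) (j + 1) (by omega), psiStar_apply]
        -- At most one term of the recursion contributes: the stone stops if it has reached `g 0`,
        -- and otherwise must move on.
        by_cases hjg : j = g 0
        · have hgN : g 0 ∈ N.black := hN ▸ Set.mem_range_self 0
          subst hjg
          rw [if_pos hgN, blackBelow_eq_zero_of_range hg hN, pow_zero, one_mul,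
            ih _ _ _ _ n hf' hg' hM' hN' (fun i hi => hfg (i + 1) (by omega))
              (fun i hi => hK (i + 1) (by omega)),
            if_neg (c := _ ∧ _ ∧ _ ∧ _) (fun h => by have := h.1; omega), add_zero]
          refine if_congr ?_ rfl rfl
          have hlt : g 0 < f 1 := by omega
          simp only [le_refl, hlt, true_and, sub_self, add_zero]
        -- Stopping at a higher site `g k` would leave `g 0 < f 1` to be filled by the remaining
        -- stones, which only move right.
        · have hz : (if j ∈ N.black then (-1 : ℂ) ^ N.blackBelow j *
              gammaPlus (-n) (basisVec (M.putWhite (f 0))) (N.putWhite j) else 0) = 0 := by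
            split_ifs with hjN
            · rw [hN] at hjN
              obtain ⟨k, rfl⟩ := hjN
              have hk : g 0 < g k := by
                refine hg (Nat.pos_of_ne_zero ?_)
                rintro rfl
                exact hjg rfl
              rw [gammaPlus_apply_eq_zero K _ _ _ n hf' hM' (fun i hi => hK (i + 1) (by omega))
                ⟨g 0, Maya.mem_putWhite.2 ⟨hN ▸ Set.mem_range_self 0, hk.ne⟩,
                  by simp only [zero_add]; omega⟩, mul_zero]
            · rfl
          rw [hz, zero_add]
          refine if_congr ?_ rfl rfl
          refine and_congr (by omega) (and_congr Iff.rfl (and_congr Iff.rfl (by omega)))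
    have h := key (f 1 - f 0).toNat n (f 0) (by omega)
    rw [psiStar_basisVec_putWhite hf hM] at h
    rw [h, Finset.sum_range_succ']
    refine if_congr ?_ rfl rfl
    constructor
    · rintro ⟨h1, h2, h3, h4⟩
      refine ⟨fun i => ?_, h4⟩
      rcases i with _ | i
      · exact ⟨h1, h2⟩
      · exact h3 i
    · rintro ⟨h1, h2⟩
      exact ⟨(h1 0).1, (h1 0).2, fun i => h1 (i + 1), h2⟩

/-! ### Transposition -/

/-- The symmetric bilinear form on the Fock space for which the basis vectors are orthonormal. -/
noncomputable def pairing : Fock →ₗ[ℂ] Module.Dual ℂ Fock :=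
  Finsupp.linearCombination ℂ fun M : Maya => Finsupp.lapply M

theorem pairing_basisVec (M : Maya) (v : Fock) : pairing (basisVec M) v = v M := by
  simp [pairing, basisVec]

theorem vacBra_apply (v : Fock) : vacBra v = pairing vacKet v := (pairing_basisVec _ v).symm

theorem pairing_comm (u v : Fock) : pairing u v = pairing v u := by
  have h : pairing = pairing.flip := by
    refine Finsupp.lhom_ext' fun M => LinearMap.ext_ring (Finsupp.lhom_ext' fun N =>
      LinearMap.ext_ring ?_)
    change pairing (basisVec M) (basisVec N) = pairing (basisVec N) (basisVec M)
    classical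
    rw [pairing_basisVec, pairing_basisVec, basisVec_apply, basisVec_apply]
    exact if_congr eq_comm rfl rfl
  exact LinearMap.congr_fun (LinearMap.congr_fun h u) v

/-- `Y` is the transpose of `X`. -/
def IsTranspose (X Y : Module.End ℂ Fock) : Prop :=
  ∀ u v, pairing (X u) v = pairing u (Y v)

namespace IsTranspose

theorem of_basisVec {X Y : Module.End ℂ Fock}
    (h : ∀ M N, X (basisVec M) N = Y (basisVec N) M) : IsTranspose X Y := by
  have h' : pairing ∘ₗ X = (pairing.flip ∘ₗ Y).flip := by
    refine Finsupp.lhom_ext' fun M => LinearMap.ext_ring (Finsupp.lhom_ext' fun N =>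
      LinearMap.ext_ring ?_)
    change pairing (X (basisVec M)) (basisVec N) = pairing (basisVec M) (Y (basisVec N))
    rw [pairing_comm, pairing_basisVec, pairing_basisVec, h]
  exact fun u v => LinearMap.congr_fun (LinearMap.congr_fun h' u) v

theorem symm {X Y : Module.End ℂ Fock} (h : IsTranspose X Y) : IsTranspose Y X := fun u v => by
  rw [pairing_comm, ← h, pairing_comm]

theorem one : IsTranspose 1 1 := fun _ _ => rfl

theorem mul {X Y X' Y' : Module.End ℂ Fock} (h : IsTranspose X Y) (h' : IsTranspose X' Y') :
    IsTranspose (X * X') (Y' * Y) := fun u v => (h _ v).trans (h' u _)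

theorem zero : IsTranspose 0 0 := fun u v => by simp

theorem smul {X Y : Module.End ℂ Fock} (c : ℂ) (h : IsTranspose X Y) :
    IsTranspose (c • X) (c • Y) := fun u v => by
  rw [LinearMap.smul_apply, LinearMap.smul_apply, map_smul, map_smul, LinearMap.smul_apply, h]

theorem sum {ι : Type*} (s : Finset ι) {X Y : ι → Module.End ℂ Fock}
    (h : ∀ i, IsTranspose (X i) (Y i)) : IsTranspose (∑ i ∈ s, X i) (∑ i ∈ s, Y i) := fun u v => by
  rw [LinearMap.sum_apply, LinearMap.sum_apply, map_sum, map_sum, LinearMap.sum_apply]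
  exact Finset.sum_congr rfl fun i _ => h i u v

theorem list_prod {ι : Type*} {X Y : ι → Module.End ℂ Fock}
    (h : ∀ i, IsTranspose (X i) (Y i)) (L : List ι) :
    IsTranspose (L.map X).prod (L.reverse.map Y).prod := by
  induction L with
  | nil => exact one
  | cons a L ih =>
    rw [List.reverse_cons, List.map_append, List.prod_append, List.map_cons, List.prod_cons,
      List.map_cons, List.map_nil, List.prod_cons, List.prod_nil, mul_one]
    exact (h a).mul ih

theorem coeff_pow {A A' : PowerSeries (Module.End ℂ Fock)}
    (h : ∀ n, IsTranspose (PowerSeries.coeff n A) (PowerSeries.coeff n A')) (k n : ℕ) :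
    IsTranspose (PowerSeries.coeff n (A ^ k)) (PowerSeries.coeff n (A' ^ k)) := by
  induction k generalizing n with
  | zero =>
    rw [pow_zero, pow_zero, PowerSeries.coeff_one]
    split_ifs
    · exact one
    · exact zero
  | succ k ih =>
    -- Transposition reverses products, so the extra factor is split off on opposite sides.
    rw [pow_succ, pow_succ', PowerSeries.coeff_mul, PowerSeries.coeff_mul,
      ← Finset.Nat.sum_antidiagonal_swap]
    exact sum _ fun x => (ih _).mul (h _)

theorem coeff_expSeries {A A' : PowerSeries (Module.End ℂ Fock)}
    (h : ∀ n, IsTranspose (PowerSeries.coeff n A) (PowerSeries.coeff n A')) (n : ℕ) :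
    IsTranspose (PowerSeries.coeff n (expSeries A)) (PowerSeries.coeff n (expSeries A')) := by
  rw [expSeries, expSeries, PowerSeries.coeff_mk, PowerSeries.coeff_mk]
  exact sum _ fun k => (coeff_pow h k n).smul _

end IsTranspose

/-- Both signs count the stones strictly left of `m`, a number unaffected by the stone at `m`. -/
theorem isTranspose_psi (m : ℤ) : IsTranspose (psi m) (psiStar m) := by
  classical
  refine .of_basisVec fun M N => ?_
  rw [psi_basisVec, psiStar_apply]
  split_ifs
  · rw [Finsupp.smul_apply, basisVec_apply, basisVec_apply, smul_eq_mul]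
    congr 1
    exact if_congr eq_comm rfl rfl
  · rfl

theorem isTranspose_normalOrdered (i j : ℤ) :
    IsTranspose (normalOrdered i j) (normalOrdered j i) := by
  have h : IsTranspose (psi i * psiStar j) (psi j * psiStar i) :=
    (isTranspose_psi i).mul (isTranspose_psi j).symm
  intro u v
  have hv : vacBra (psi i (psiStar j vacKet)) = vacBra (psi j (psiStar i vacKet)) := by
    rw [vacBra_apply, vacBra_apply, pairing_comm]
    exact h vacKet vacKet
  rw [normalOrdered_apply, normalOrdered_apply, map_sub, map_sub, map_smul, map_smul, hv,
    LinearMap.sub_apply, LinearMap.smul_apply]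
  congr 1
  exact h u v

/-- Transposing exchanges the two indices of each summand; the shift `j ↦ j + m` then matches the
sums. -/
theorem isTranspose_heis (m : ℤ) : IsTranspose (heis m) (heis (-m)) := by
  intro u v
  have h1 : pairing (heis m u) v = ∑ᶠ j : ℤ, pairing (normalOrdered j (j + m) u) v := by
    rw [heis_apply, pairing_comm]
    refine ((pairing v).toAddMonoidHom.map_finsum (finite_support_normalOrdered_apply m u)).trans ?_
    exact finsum_congr fun j => pairing_comm _ _
  have h2 : pairing u (heis (-m) v) = ∑ᶠ j : ℤ, pairing u (normalOrdered j (j + -m) v) := by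
    rw [heis_apply]
    exact (pairing u).toAddMonoidHom.map_finsum (finite_support_normalOrdered_apply (-m) v)
  rw [h1, h2, ← finsum_comp_equiv (Equiv.addRight m)
    (f := fun k => pairing u (normalOrdered k (k + -m) v))]
  refine finsum_congr fun j => ?_
  rw [isTranspose_normalOrdered, Equiv.coe_addRight, add_neg_cancel_right]

theorem isTranspose_gammaMinus (d : ℤ) : IsTranspose (gammaMinus d) (gammaPlus (-d)) := by
  rw [gammaMinus, gammaPlus, Int.natAbs_neg]
  by_cases hd : 0 ≤ d
  · rw [if_pos hd, if_pos (by omega)]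
    refine .coeff_expSeries (fun n => ?_) _
    rw [PowerSeries.coeff_mk, PowerSeries.coeff_mk]
    split_ifs
    · exact .zero
    · exact (isTranspose_heis _).symm.smul _
  · rw [if_neg hd, if_neg (by omega)]
    exact .zero

/-- The operator word in `⟨μ|` is the one in `|μ⟩` reversed with `ψ` and `ψ*` exchanged, hence its
transpose, and both carry the sign `(-1)^κ`. -/
theorem bra_apply (μ : YoungDiagram) (v : Fock) : bra μ v = pairing (ket μ) v := by
  have h := IsTranspose.mul
    (IsTranspose.list_prod (fun j => isTranspose_psi (mCoord μ j)) (List.range (hookCount μ)))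
    (IsTranspose.list_prod (fun j => (isTranspose_psi (nCoord μ j)).symm)
      (List.range (hookCount μ)))
  rw [bra, ket, map_smul, LinearMap.smul_apply, LinearMap.smul_apply, h, LinearMap.comp_apply,
    vacBra_apply]

/-! ### Frobenius coordinates and the sites `i - μ_i` -/

/-- The diagonal boxes form an initial segment, so their number is the threshold for membership. -/
theorem mem_diagonal_iff (μ : YoungDiagram) (i : ℕ) : (i, i) ∈ μ ↔ i < hookCount μ := by
  have hle : ∀ i j, i ≤ j → (j, j) ∈ μ → (i, i) ∈ μ := fun i j h => μ.up_left_mem h h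
  have hcard : hookCount μ = ((μ.cells.filter fun c => c.1 = c.2).image Prod.fst).card := by
    rw [hookCount, Finset.card_image_of_injOn]
    rintro ⟨a, b⟩ ha ⟨c, d⟩ hc h
    simp only [Finset.coe_filter, Set.mem_ofPred_eq] at ha hc h
    ext <;> dsimp only <;> omega
  set s := (μ.cells.filter fun c => c.1 = c.2).image Prod.fst with hs
  have hmem (i : ℕ) : i ∈ s ↔ (i, i) ∈ μ := by
    simp only [hs, Finset.mem_image, Finset.mem_filter, YoungDiagram.mem_cells, Prod.exists]
    constructor
    · rintro ⟨a, b, ⟨h, hab⟩, hi⟩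
      obtain rfl : a = b := hab
      obtain rfl : a = i := hi
      exact h
    · exact fun h => ⟨i, i, ⟨h, rfl⟩, rfl⟩
  rw [hcard]
  constructor
  · intro h
    have hsub : Finset.range (i + 1) ⊆ s := fun j hj =>
      (hmem j).2 (hle j i (by rw [Finset.mem_range] at hj; omega) h)
    have := Finset.card_le_card hsub
    rw [Finset.card_range] at this
    omega
  · intro h
    by_contra hi
    have hsub : s ⊆ Finset.range i := fun j hj => by
      rw [Finset.mem_range]
      by_contra hij
      exact hi (hle i j (by omega) ((hmem j).1 hj))
    have := Finset.card_le_card hsub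
    rw [Finset.card_range] at this
    omega

theorem lt_rowLen_iff_lt_colLen (μ : YoungDiagram) (i j : ℕ) :
    j < μ.rowLen i ↔ i < μ.colLen j := by
  rw [← YoungDiagram.mem_iff_lt_rowLen, YoungDiagram.mem_iff_lt_colLen]

theorem lt_hookCount_iff_rowLen (μ : YoungDiagram) (i : ℕ) : i < hookCount μ ↔ i < μ.rowLen i := by
  rw [← mem_diagonal_iff, YoungDiagram.mem_iff_lt_rowLen]

theorem lt_hookCount_iff_colLen (μ : YoungDiagram) (i : ℕ) : i < hookCount μ ↔ i < μ.colLen i := by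
  rw [← mem_diagonal_iff, YoungDiagram.mem_iff_lt_colLen]

theorem strictMono_sub_rowLen (μ : YoungDiagram) : StrictMono fun i : ℕ => (i : ℤ) - μ.rowLen i :=
  strictMono_nat_of_lt_succ fun i => by
    have := μ.rowLen_anti i (i + 1) (Nat.le_succ i)
    push_cast
    omega

/-- The Frobenius description of the sites `i - μ_i` (with `i ≥ 0`). -/
theorem range_sub_rowLen (μ : YoungDiagram) :
    Set.range (fun i : ℕ => (i : ℤ) - μ.rowLen i) =
      (Set.Ici 0 ∪ {x | ∃ j < hookCount μ, x = nCoord μ j}) \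
        {x | ∃ j < hookCount μ, x = mCoord μ j} := by
  ext x
  simp only [Set.mem_range, Set.mem_sdiff, Set.mem_union, Set.mem_Ici, Set.mem_ofPred_eq, not_exists,
    not_and]
  constructor
  · rintro ⟨i, rfl⟩
    refine ⟨?_, fun j hj hx => ?_⟩
    · by_cases hi : i < hookCount μ
      · exact Or.inr ⟨i, hi, by rw [nCoord]; ring⟩
      · rw [lt_hookCount_iff_rowLen] at hi
        left
        omega
    -- `rowLen i - j` and `colLen j - i` are both positive or both nonpositive, according to whether
    -- the box `(i, j)` is in `μ`; equality of the two sites would force their sum to be 1.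
    · have h1 := (lt_hookCount_iff_colLen μ j).1 hj
      have h2 := lt_rowLen_iff_lt_colLen μ i j
      rw [mCoord] at hx
      omega
  · rintro ⟨hx | ⟨j, hj, rfl⟩, hm⟩
    · by_contra hcon
      have hex : ∃ i : ℕ, x ≤ (i : ℤ) - μ.rowLen i := by
        refine ⟨μ.colLen 0 + x.toNat, ?_⟩
        have := lt_rowLen_iff_lt_colLen μ (μ.colLen 0 + x.toNat) 0
        omega
      classical
      -- A missing `x ≥ 0` lies strictly between two consecutive values; with `i` the row just
      -- before the gap, column `j = i - x` has length exactly `i + 1`, so `x` is its `mCoord`.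
      obtain ⟨i, hi, hmin⟩ : ∃ i : ℕ, x ≤ (i : ℤ) - μ.rowLen i ∧
          ∀ k < i, ¬ x ≤ (k : ℤ) - μ.rowLen k :=
        ⟨Nat.find hex, Nat.find_spec hex, fun k hk => Nat.find_min hex hk⟩
      have hne : (i : ℤ) - μ.rowLen i ≠ x := fun h => hcon ⟨i, h⟩
      rcases i with _ | i
      · push_cast at hi hne
        omega
      have hprev := hmin i (Nat.lt_succ_self i)
      obtain ⟨j, hj⟩ : ∃ j : ℕ, (j : ℤ) = i - x := ⟨(i - x).toNat, by push_cast at hi hne; omega⟩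
      have h1 := lt_rowLen_iff_lt_colLen μ i j
      have h2 := lt_rowLen_iff_lt_colLen μ (i + 1) j
      push_cast at hi hne
      have hcol : μ.colLen j = i + 1 := by omega
      refine hm j ((lt_hookCount_iff_colLen μ j).2 (by omega)) ?_
      rw [mCoord, hcol]
      omega
    · exact ⟨j, by rw [nCoord]; ring⟩

/-! ### The states `|μ⟩` as basis vectors -/

theorem blackBelow_vacuum (x : ℕ) : Maya.vacuum.blackBelow x = x := by
  have h : Maya.vacuum.black ∩ Set.Iio (x : ℤ) = (Finset.Ico (0 : ℤ) x : Set ℤ) := by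
    rw [Finset.coe_Ico]
    rfl
  rw [Maya.blackBelow, h, Set.ncard_coe_finset, Int.card_Ico]
  simp

/-- Adding black stones on the left of the vacuum, from right to left. -/
theorem psiStar_list_prod_vacKet {n : ℕ → ℤ} {r : ℕ} (hneg : ∀ j < r, n j < 0)
    (hn : ∀ i j, i < j → j < r → n i < n j) (t : ℕ) : ∀ s, s + t = r →
    ∃ M : Maya, (((List.range' s t).map fun j => psiStar (n j)).prod) vacKet = basisVec M ∧
      M.black = Set.Ici 0 ∪ {x | ∃ j, s ≤ j ∧ j < r ∧ x = n j} ∧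
      ∀ x : ℕ, M.blackBelow x = x + t := by
  induction t with
  | zero =>
    intro s hs
    refine ⟨Maya.vacuum, rfl, ?_, fun x => blackBelow_vacuum x⟩
    ext x
    simp only [Maya.mem_vacuum, Set.mem_union, Set.mem_Ici, Set.mem_ofPred_eq]
    constructor
    · exact Or.inl
    · rintro (h | ⟨j, h1, h2, -⟩)
      · exact h
      · omega
  | succ t ih =>
    intro s hs
    obtain ⟨M, hM, hblack, hbelow⟩ := ih (s + 1) (by omega)
    have hns : n s < 0 := hneg s (by omega)
    -- Each new stone lies below all present ones, so no sign arises.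
    have hlow : ∀ y ∈ M.black, n s < y := by
      intro y hy
      rw [hblack] at hy
      rcases hy with hy | ⟨j, h1, h2, rfl⟩
      · exact lt_of_lt_of_le hns hy
      · exact hn s j (by omega) h2
    have hnot : n s ∉ M.black := fun h => lt_irrefl _ (hlow _ h)
    refine ⟨M.putBlack (n s), ?_, ?_, fun x => ?_⟩
    · rw [List.range'_succ, List.map_cons, List.prod_cons, Module.End.mul_apply, hM,
        psiStar_basisVec, if_neg hnot, Maya.blackBelow_eq_zero fun y hy => (hlow y hy).le, pow_zero,
        one_smul]
    · ext x
      rw [Maya.mem_putBlack, hblack]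
      simp only [Set.mem_union, Set.mem_Ici, Set.mem_ofPred_eq]
      constructor
      · rintro ((h | ⟨j, h1, h2, h3⟩) | h)
        · exact Or.inl h
        · exact Or.inr ⟨j, by omega, h2, h3⟩
        · exact Or.inr ⟨s, le_rfl, by omega, h⟩
      · rintro (h | ⟨j, h1, h2, h3⟩)
        · exact Or.inl (Or.inl h)
        · rcases h1.eq_or_lt with rfl | h1
          · exact Or.inr h3
          · exact Or.inl (Or.inr ⟨j, h1, h2, h3⟩)
    · rw [Maya.blackBelow_putBlack_of_lt hnot (by omega), hbelow, add_assoc]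

/-- Removing black stones, from left to right. -/
theorem psi_list_prod_basisVec {m : ℕ → ℕ} {r : ℕ} (hm : ∀ i j, i < j → j < r → m j < m i)
    {M : Maya} (hmem : ∀ j < r, (m j : ℤ) ∈ M.black)
    (hbelow : ∀ x : ℕ, M.blackBelow x = x + r) (t : ℕ) : ∀ s, s + t = r →
    ∃ N : Maya, (((List.range' s t).map fun j => psi (m j)).prod) (basisVec M) =
        (-1 : ℂ) ^ (∑ j ∈ Finset.Ico s r, (m j + (j + 1))) • basisVec N ∧
      N.black = M.black \ {x | ∃ j, s ≤ j ∧ j < r ∧ x = m j} ∧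
      ∀ x : ℕ, (∀ j, s ≤ j → j < r → m j < x) → N.blackBelow x + t = x + r := by
  induction t with
  | zero =>
    intro s hs
    refine ⟨M, ?_, ?_, fun x _ => hbelow x⟩
    · rw [Finset.Ico_eq_empty (by omega), Finset.sum_empty, pow_zero, one_smul]
      rfl
    · ext x
      simp only [Set.mem_sdiff, Set.mem_ofPred_eq, not_exists, not_and]
      exact ⟨fun h => ⟨h, fun j _ _ => by omega⟩, fun h => h.1⟩
  | succ t ih =>
    intro s hs
    obtain ⟨N, hN, hblack, hb⟩ := ih (s + 1) (by omega)
    have hmemN : (m s : ℤ) ∈ N.black := by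
      rw [hblack]
      refine ⟨hmem s (by omega), ?_⟩
      rintro ⟨j, h1, h2, h3⟩
      have := hm s j (by omega) h2
      omega
    -- The smaller sites `m j` with `j > s` are already empty, so `m s + r - t = m s + (s + 1)`
    -- stones lie below `m s`: the summand of `κ`.
    have hbs := hb (m s) fun j h1 h2 => hm s j (by omega) h2
    refine ⟨N.putWhite (m s), ?_, ?_, fun x hx => ?_⟩
    · rw [List.range'_succ, List.map_cons, List.prod_cons, Module.End.mul_apply, hN, map_smul,
        psi_basisVec, if_pos hmemN, smul_smul, Finset.sum_eq_sum_Ico_succ_bot (by omega : s < r)]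
      congr 1
      rw [mul_comm, pow_add, show N.blackBelow (m s) = m s + (s + 1) by omega]
    · ext x
      rw [Maya.mem_putWhite, hblack]
      simp only [Set.mem_sdiff, Set.mem_ofPred_eq, not_exists, not_and]
      constructor
      · rintro ⟨⟨h1, h2⟩, h3⟩
        refine ⟨h1, fun j hj hr hx => ?_⟩
        rcases hj.eq_or_lt with rfl | hj
        · exact h3 hx
        · exact h2 j hj hr hx
      · rintro ⟨h1, h2⟩
        exact ⟨⟨h1, fun j hj => h2 j (by omega)⟩, h2 s le_rfl (by omega)⟩
    · have h1 := hb x fun j hj hr => hx j (by omega) hr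
      have h2 := Maya.blackBelow_putWhite_of_lt hmemN
        (Int.ofNat_lt.2 (hx s le_rfl (by omega)))
      omega

/-- The state `|μ⟩` is the basis vector with black sites `i - μ_i`, `i ≥ 0`. -/
theorem exists_ket_eq_basisVec (μ : YoungDiagram) :
    ∃ M : Maya, ket μ = basisVec M ∧
      M.black = Set.range fun i : ℕ => (i : ℤ) - μ.rowLen i := by
  obtain ⟨M, hM, hMblack, hMbelow⟩ :=
    psiStar_list_prod_vacKet (n := nCoord μ) (r := hookCount μ)
      (fun j hj => by
        have := (lt_hookCount_iff_rowLen μ j).1 hj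
        rw [nCoord]
        omega)
      (fun i j hij _ => by
        have := strictMono_sub_rowLen μ hij
        simp only [nCoord]
        dsimp only at this
        omega) (hookCount μ) 0 (zero_add _)
  obtain ⟨N, hN, hNblack, -⟩ :=
    psi_list_prod_basisVec (m := mCoord μ) (r := hookCount μ) (M := M)
      (fun i j hij hj => by
        have h1 := (lt_hookCount_iff_colLen μ j).1 hj
        have h2 := μ.colLen_anti i j hij.le
        simp only [mCoord]
        omega)
      (fun j _ => by
        rw [hMblack]
        exact Or.inl (Int.natCast_nonneg _))
      hMbelow (hookCount μ) 0 (zero_add _)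
  refine ⟨N, ?_, ?_⟩
  · rw [ket, Module.End.mul_apply, List.range_eq_range', hM, hN, smul_smul, kappa,
      Finset.range_eq_Ico, ← mul_pow, neg_one_mul, neg_neg, one_pow, one_smul]
  · rw [hNblack, hMblack, range_sub_rowLen]
    simp only [Nat.zero_le, true_and]

/-! ### From Maya diagrams to interlacing partitions -/

theorem sum_rowLen (μ : YoungDiagram) {K : ℕ} (hK : μ.colLen 0 ≤ K) :
    ∑ i ∈ Finset.range K, μ.rowLen i = μ.card := by
  rw [YoungDiagram.card, Finset.card_eq_sum_card_fiberwise (f := Prod.fst) (t := Finset.range K)]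
  · exact Finset.sum_congr rfl fun i _ => μ.rowLen_eq_card
  · rintro ⟨i, j⟩ h
    have h' : (i, j) ∈ μ := h
    have := YoungDiagram.mem_iff_lt_colLen.1 (μ.up_left_mem le_rfl (Nat.zero_le j) h')
    simp only [Finset.coe_range, Set.mem_Iio]
    omega

theorem rowLen_eq_zero (μ : YoungDiagram) {i : ℕ} (hi : μ.colLen 0 ≤ i) : μ.rowLen i = 0 := by
  have := lt_rowLen_iff_lt_colLen μ i 0
  omega

open Classical in
theorem pairing_ket_gammaPlus_ket (μ ν : YoungDiagram) (n : ℤ) :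
    pairing (ket ν) (gammaPlus (-n) (ket μ)) =
      if Interlaces ν μ ∧ (μ.card : ℤ) - ν.card = n then 1 else 0 := by
  obtain ⟨M, hM, hMblack⟩ := exists_ket_eq_basisVec μ
  obtain ⟨N, hN, hNblack⟩ := exists_ket_eq_basisVec ν
  have hμ (i : ℕ) (hi : max (μ.colLen 0) (ν.colLen 0) ≤ i) : μ.rowLen i = 0 :=
    rowLen_eq_zero μ ((le_max_left _ _).trans hi)
  have hν (i : ℕ) (hi : max (μ.colLen 0) (ν.colLen 0) ≤ i) : ν.rowLen i = 0 :=
    rowLen_eq_zero ν ((le_max_right _ _).trans hi)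
  rw [hM, hN, pairing_basisVec,
    gammaPlus_apply_of_range (max (μ.colLen 0) (ν.colLen 0)) _ _ M N n
      (strictMono_sub_rowLen μ) (strictMono_sub_rowLen ν) hMblack hNblack
      (fun i hi => by rw [hμ i hi, hν i hi])
      (fun i hi => by rw [hμ i hi, hμ (i + 1) (by omega)]; push_cast; ring)]
  refine if_congr (and_congr (forall_congr' fun i => ?_) ?_) rfl rfl
  -- The strict bound `g i < f (i + 1)` becomes the weak `μ_{i+1} ≤ ν_i` because the row index also
  -- grows by one.
  · push_cast
    omega
  · rw [← sum_rowLen μ (le_max_left _ (ν.colLen 0)), ← sum_rowLen ν (le_max_right (μ.colLen 0) _)]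
    push_cast
    rw [← Finset.sum_sub_distrib]
    simp only [sub_sub_sub_cancel_left]

end ChargedFermion

open Classical in
theorem lemma1 (μ ν : YoungDiagram) :
    ChargedFermion.matrixElement ν ChargedFermion.gammaPlus μ =
        (if ChargedFermion.Interlaces ν μ then
          ChargedFermion.zMonomial ((ν.card : ℤ) - (μ.card : ℤ)) else 0) ∧
      ChargedFermion.matrixElement μ ChargedFermion.gammaMinus ν =
        (if ChargedFermion.Interlaces ν μ then
          ChargedFermion.zMonomial ((μ.card : ℤ) - (ν.card : ℤ)) else 0) := by
  constructor
  · funext d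
    have h := ChargedFermion.pairing_ket_gammaPlus_ket μ ν (-d)
    rw [neg_neg] at h
    rw [ChargedFermion.matrixElement, ChargedFermion.bra_apply, h]
    by_cases hi : ChargedFermion.Interlaces ν μ
    · rw [if_pos hi, ChargedFermion.zMonomial, Pi.single_apply]
      refine if_congr ?_ rfl rfl
      simp only [hi, true_and]
      omega
    · rw [if_neg hi, if_neg fun h => hi h.1, Pi.zero_apply]
  · funext d
    -- The `z^d` coefficient of `Γ₋` is the transpose of the `z^{-d}` coefficient of `Γ₊`, so the
    -- first computation applies with `n = d`.
    rw [ChargedFermion.matrixElement, ChargedFermion.bra_apply, ChargedFermion.pairing_comm,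
      ChargedFermion.isTranspose_gammaMinus, ChargedFermion.pairing_ket_gammaPlus_ket]
    by_cases hi : ChargedFermion.Interlaces ν μ
    · rw [if_pos hi, ChargedFermion.zMonomial, Pi.single_apply]
      refine if_congr ?_ rfl rfl
      simp only [hi, true_and]
      omega
    · rw [if_neg hi, if_neg fun h => hi h.1, Pi.zero_apply]
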